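/- Let $1\le p<\infty$ and let $X,Y$ be Banach spaces over $\mathbb K$, where $\mathbb K=\mathbb R$ or $\mathbb K=\mathbb C$; $\ell_p$ denotes the space of $p$-summable sequences in $\mathbb K$. A subset $A$ of a Banach space $Z$ is called coarse $p$-limited if $S(A)$ is relatively compact in $\ell_p$ for every bounded linear operator $S:Z\to\ell_p$. The space $Z$ has the coarse $p$-DP* property if every relatively weakly compact subset of $Z$ is coarse $p$-limited. A bounded linear operator $T:X\to Y$ is coarse $p$-limited if the image $T(B_X)$ of the closed unit ball $B_X$ of $X$ is a coarse $p$-limited subset of $Y$. A sequence $(z_n)$ in $Z$ is equivalent to the canonical basis of $\ell_1$ if there are constants $c,C>0$ with $$c\sum_{n\in F}|a_n|\le\Big\|\sum_{n\in F}a_nz_n\Big\|\le C\sum_{n\in F}|a_n|$$ for all finite sets $F\subset\mathbb N$ and all scalars $a_n$. Suppose that $X$ has the coarse $p$-DP* property. 1. If $T:X\to Y$ is a bounded linear operator that is not coarse $p$-limited, then there is a sequence $(x_n)$ in $X$ that is equivalent to the canonical basis of $\ell_1$ and such that, if moreover $Y$ has the coarse $p$-DP* property, then $(Tx_n)$ has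 a subsequence that is equivalent to the canonical basis of $\ell_1$. 2. Consequently, if $X$ contains no linear subspace linearly homeomorphic to $\ell_1$, then every bounded linear operator from $X$ into any Banach space $Y$ is coarse $p$-limited. -/

import Mathlib

open scoped ENNReal

namespace CoarseLimited

/-- The Banach sequence space `ℓ_p` of scalar sequences indexed by `ℕ`. -/
abbrev SeqSpace (𝕜 : Type*) [RCLike 𝕜] (p : ℝ≥0∞) : Type _ :=
  ↥(lp (fun _ : ℕ => 𝕜) p)

/-- The `n`-th canonical unit vector of `ℓ_1`. -/
noncomputable def l1Basis (𝕜 : Type*) [RCLike 𝕜] (n : ℕ) : SeqSpace 𝕜 1 :=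
  lp.single (E := fun _ : ℕ => 𝕜) 1 n (1 : 𝕜)

/-- `A ⊆ X` is coarse `p`-limited if `S(A)` is relatively compact in `ℓ_p` for every bounded
linear operator `S : X → ℓ_p`. -/
def IsCoarseLimitedSet (𝕜 : Type*) [RCLike 𝕜] {X : Type*} [NormedAddCommGroup X]
    [NormedSpace 𝕜 X] (p : ℝ≥0∞) [Fact (1 ≤ p)] (A : Set X) : Prop :=
  ∀ S : X →L[𝕜] SeqSpace 𝕜 p, IsCompact (closure (S '' A))

/-- `A ⊆ X` is relatively weakly compact if its closure in the weak topology is weakly compact. -/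
def IsRelWeaklyCompact (𝕜 : Type*) [RCLike 𝕜] {X : Type*} [NormedAddCommGroup X]
    [NormedSpace 𝕜 X] (A : Set X) : Prop :=
  IsCompact (closure (toWeakSpace 𝕜 X '' A))

/-- The coarse `p`-DP* property: every relatively weakly compact set is coarse `p`-limited. -/
def HasCoarseDPStar (𝕜 : Type*) [RCLike 𝕜] (X : Type*) [NormedAddCommGroup X]
    [NormedSpace 𝕜 X] (p : ℝ≥0∞) [Fact (1 ≤ p)] : Prop :=
  ∀ A : Set X, IsRelWeaklyCompact 𝕜 A → IsCoarseLimitedSet 𝕜 p A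

/-- A bounded operator is coarse `p`-limited if it maps the closed unit ball to a coarse
`p`-limited set. -/
def IsCoarseLimitedOp {𝕜 : Type*} [RCLike 𝕜] {X Y : Type*} [NormedAddCommGroup X]
    [NormedSpace 𝕜 X] [NormedAddCommGroup Y] [NormedSpace 𝕜 Y] (p : ℝ≥0∞) [Fact (1 ≤ p)]
    (T : X →L[𝕜] Y) : Prop :=
  IsCoarseLimitedSet 𝕜 p (T '' Metric.closedBall (0 : X) 1)

/-- Equivalence of sequences `(x_n)` and `(y_n)` in normed spaces: for some constants
`c, C > 0`, all finite linear combinations satisfy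
`c ‖∑ a_n y_n‖ ≤ ‖∑ a_n x_n‖ ≤ C ‖∑ a_n y_n‖`. -/
def SeqEquivalent (𝕜 : Type*) [RCLike 𝕜] {X Z : Type*} [NormedAddCommGroup X]
    [NormedSpace 𝕜 X] [NormedAddCommGroup Z] [NormedSpace 𝕜 Z] (x : ℕ → X) (y : ℕ → Z) : Prop :=
  ∃ c C : ℝ, 0 < c ∧ 0 < C ∧ ∀ (s : Finset ℕ) (a : ℕ → 𝕜),
    c * ‖∑ n ∈ s, a n • y n‖ ≤ ‖∑ n ∈ s, a n • x n‖ ∧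
      ‖∑ n ∈ s, a n • x n‖ ≤ C * ‖∑ n ∈ s, a n • y n‖

/-- `X` contains a copy of `ℓ_1`: some linear subspace of `X` is linearly homeomorphic to `ℓ_1`
(such a subspace is automatically closed). -/
def ContainsCopyOfL1 (𝕜 : Type*) [RCLike 𝕜] (X : Type*) [NormedAddCommGroup X]
    [NormedSpace 𝕜 X] : Prop :=
  ∃ M : Submodule 𝕜 X, Nonempty (SeqSpace 𝕜 1 ≃L[𝕜] M)

end CoarseLimited

/-!
Let `T : X → Y` fail to be coarse `p`-limited, and let `S : Y → ℓ_p` witness it. Then some sequence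
`x` in the unit ball of `X` has an image under `S ∘ T` that is separated: its terms are at mutual
distance at least `ε > 0`. By Rosenthal's `ℓ₁` theorem
(`exists_seqEquivalent_l1Basis_or_weakCauchy`), `x` has either a subsequence equivalent to the
basis of `ℓ₁`, which is what we want, or a weakly Cauchy subsequence. The second case is
impossible: the successive differences of a weakly Cauchy sequence are weakly null, hence form a
relatively weakly compact set, and the coarse `p`-DP* property makes a subsequence of their images
in `ℓ_p` converge in norm, necessarily to `0`, against the separation
(`HasCoarseDPStar.exists_seqEquivalent_l1Basis`). This argument uses only that the sequence is
bounded and has separated images, so it applies in the same way to `T x` and `S` in `Y`. A sequence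
equivalent to the basis of `ℓ₁` spans a copy of `ℓ₁`, which gives the second assertion.

Rosenthal's theorem is proved for real and complex scalars at once. Fix two small, well separated
closed discs in `𝕜`, and let `A n` and `B n` be the sets of functionals `f` in the dual ball with
`f (x n)` in the first and in the second disc. If along some infinite set of indices no further
infinite set makes every `f` eventually leave one of the two discs, then a tree construction
(`Oscillates.exists_independent`) gives a subsequence along which the pairs `(A n, B n)` are
independent, and independence gives the lower `ℓ₁`-estimate
(`seqEquivalent_l1Basis_of_independent`). If this happens for none of countably many pairs of discs,
a diagonal argument gives a subsequence settling for all of them, and `f (x n)` converges along it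
for every `f` in the ball.
-/

open Filter Topology

namespace CoarseLimited

/-! ### Oscillation along infinite sets of indices, and independent pairs of sets -/

section Combinatorics

variable {Ω : Type*}

/-- Diagonal argument: countably many properties of sets of indices, each stable under almost
inclusion and each attainable by passing to an infinite subset, can be attained together. -/
lemma exists_infinite_subset_forall {Q : ℕ → Set ℕ → Prop}
    (hQ : ∀ m L L', Q m L → (L' \ L).Finite → Q m L') {M : Set ℕ} (hM : M.Infinite)
    (h : ∀ m, ∀ M' ⊆ M, M'.Infinite → ∃ L ⊆ M', L.Infinite ∧ Q m L) :
    ∃ L ⊆ M, L.Infinite ∧ ∀ m, Q m L := by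
  choose! F hFsub hFinf hFQ using h
  let T : ℕ → Set ℕ := fun n => Nat.rec M (fun m S => F m S) n
  have hT : ∀ n, T n ⊆ M ∧ (T n).Infinite := by
    intro n
    induction n with
    | zero => exact ⟨subset_rfl, hM⟩
    | succ n ih => exact ⟨(hFsub n _ ih.1 ih.2).trans ih.1, hFinf n _ ih.1 ih.2⟩
  have hanti : Antitone T :=
    antitone_nat_of_succ_le fun n => hFsub n _ (hT n).1 (hT n).2
  obtain ⟨φ, hφ, hφT⟩ := extraction_forall_of_frequently
    (P := fun n k => k ∈ T n) fun n => Nat.frequently_atTop_iff_infinite.2 (hT n).2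
  refine ⟨Set.range φ, ?_, Set.infinite_range_of_injective hφ.injective, fun m => ?_⟩
  · rintro _ ⟨n, rfl⟩
    exact (hT n).1 (hφT n)
  · refine hQ m (T (m + 1)) _ (hFQ m _ (hT m).1 (hT m).2) ?_
    refine ((Set.finite_lt_nat (m + 1)).image φ).subset ?_
    rintro _ ⟨⟨n, rfl⟩, hn⟩
    refine ⟨n, ?_, rfl⟩
    by_contra hlt
    exact hn (hanti (not_lt.1 hlt) (hφT n))

/-- The pairs `(A n, B n)`, `n ∈ L`, settle on `W` if no point of `W` lies both in infinitely many
of the sets `A n` and in infinitely many of the sets `B n` with `n ∈ L`. -/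
def Settles (A B : ℕ → Set Ω) (W : Set Ω) (L : Set ℕ) : Prop :=
  ∀ ω ∈ W, {n ∈ L | ω ∈ A n}.Finite ∨ {n ∈ L | ω ∈ B n}.Finite

/-- The pairs `(A n, B n)`, `n ∈ M`, oscillate on `W` if they settle on `W` along no infinite
subset of `M`. -/
def Oscillates (A B : ℕ → Set Ω) (W : Set Ω) (M : Set ℕ) : Prop :=
  ∀ L ⊆ M, L.Infinite → ¬ Settles A B W L

variable {A B : ℕ → Set Ω}

lemma finite_sep_of_diff_finite {L L' : Set ℕ} {q : ℕ → Prop} (h : {n ∈ L | q n}.Finite)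
    (hL : (L' \ L).Finite) : {n ∈ L' | q n}.Finite := by
  refine (h.union hL).subset ?_
  rintro n ⟨hn, hq⟩
  by_cases hnL : n ∈ L
  · exact Or.inl ⟨hnL, hq⟩
  · exact Or.inr ⟨hn, hnL⟩

lemma Settles.mono {W : Set Ω} {L L' : Set ℕ} (h : Settles A B W L) (hL : (L' \ L).Finite) :
    Settles A B W L' := fun ω hω =>
  (h ω hω).imp (finite_sep_of_diff_finite · hL) (finite_sep_of_diff_finite · hL)

/-- A point of `W` in none of the sets `A m`, `m ∈ L`, settles trivially, so settling on each
`W ∩ A m` is enough. -/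
lemma settles_of_forall_inter_left {W : Set Ω} {L : Set ℕ}
    (h : ∀ m ∈ L, Settles A B (W ∩ A m) L) : Settles A B W L := by
  intro ω hω
  by_cases hA : ∃ m ∈ L, ω ∈ A m
  · obtain ⟨m, hm, hωm⟩ := hA
    exact h m hm ω ⟨hω, hωm⟩
  · refine Or.inl (Set.finite_empty.subset ?_)
    rintro n ⟨hn, hωn⟩
    exact hA ⟨n, hn, hωn⟩

lemma Settles.symm {W : Set Ω} {L : Set ℕ} (h : Settles A B W L) : Settles B A W L :=
  fun ω hω => (h ω hω).symm

/-- Splitting step of the tree construction: if the pairs oscillate on finitely many sets `W`, there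
is an index `m` such that, along a smaller set of indices, they still oscillate on all the halves
`W ∩ A m` and `W ∩ B m`. Otherwise a diagonal argument and the pigeonhole principle give an infinite
set `L` and one `W` such that the pairs settle along `L` on `W ∩ A m` for all `m ∈ L` (or on
`W ∩ B m` for all `m ∈ L`), hence on `W`. -/
lemma Oscillates.exists_split {𝒲 : Set (Set Ω)} (h𝒲 : 𝒲.Finite) {M : Set ℕ} (hM : M.Infinite)
    (h : ∀ W ∈ 𝒲, Oscillates A B W M) :
    ∃ m ∈ M, ∃ M' ⊆ M ∩ Set.Ioi m, M'.Infinite ∧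
      ∀ W ∈ 𝒲, Oscillates A B (W ∩ A m) M' ∧ Oscillates A B (W ∩ B m) M' := by
  by_contra hcon
  obtain ⟨L, hLM, hL, hQ⟩ := exists_infinite_subset_forall
    (Q := fun m L => m ∈ M → ∃ W ∈ 𝒲, Settles A B (W ∩ A m) L ∨ Settles A B (W ∩ B m) L)
    (fun m L L' hQ hLL' hm => by
      obtain ⟨W, hW, h⟩ := hQ hm
      exact ⟨W, hW, h.imp (·.mono hLL') (·.mono hLL')⟩) hM
    (fun m M' hM' hinf => by
      by_cases hm : m ∈ M
      · by_contra hno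
        refine hcon ⟨m, hm, M' ∩ Set.Ioi m, Set.inter_subset_inter_left _ hM', ?_, ?_⟩
        · refine (hinf.sdiff (Set.finite_Iic m)).mono ?_
          rintro n ⟨hn, hnm⟩
          exact ⟨hn, Set.mem_Ioi.2 (lt_of_not_ge hnm)⟩
        · intro W hW
          constructor
          · intro L hL hLinf hS
            exact hno ⟨L, hL.trans Set.inter_subset_left, hLinf, fun _ => ⟨W, hW, Or.inl hS⟩⟩
          · intro L hL hLinf hS
            exact hno ⟨L, hL.trans Set.inter_subset_left, hLinf, fun _ => ⟨W, hW, Or.inr hS⟩⟩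
      · exact ⟨M', subset_rfl, hinf, fun h => absurd h hm⟩)
  have hcover : L ⊆ ⋃ W ∈ 𝒲, ({m ∈ L | Settles A B (W ∩ A m) L} ∪
      {m ∈ L | Settles A B (W ∩ B m) L}) := by
    intro m hm
    obtain ⟨W, hW, hS⟩ := hQ m (hLM hm)
    simp only [Set.mem_iUnion]
    exact ⟨W, hW, hS.imp (⟨hm, ·⟩) (⟨hm, ·⟩)⟩
  have key : ∃ W ∈ 𝒲, {m ∈ L | Settles A B (W ∩ A m) L}.Infinite ∨
      {m ∈ L | Settles A B (W ∩ B m) L}.Infinite := by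
    by_contra hno
    push Not at hno
    refine hL ((h𝒲.biUnion fun W hW => ?_).subset hcover)
    exact (hno W hW).1.union (hno W hW).2
  have hfin : ∀ q : ℕ → Prop, ({m ∈ L | q m} \ L).Finite := fun q =>
    Set.finite_empty.subset fun n hn => hn.2 hn.1.1
  obtain ⟨W, hW, hinf | hinf⟩ := key
  · exact h W hW _ ((Set.sep_subset _ _).trans hLM) hinf
      (settles_of_forall_inter_left fun m hm => hm.2.mono (hfin _))
  · exact h W hW _ ((Set.sep_subset _ _).trans hLM) hinf
      (settles_of_forall_inter_left fun m hm => (hm.2.mono (hfin _)).symm).symm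

/-- Oscillating pairs have an independent subsequence: every choice between `A` and `B` for finitely
many of its indices is realised by a point. -/
lemma Oscillates.exists_independent {M : Set ℕ} (hM : M.Infinite)
    (h : Oscillates A B Set.univ M) :
    ∃ φ : ℕ → ℕ, StrictMono φ ∧ ∀ (s : Set ℕ) (n : ℕ), ∃ ω, ∀ k < n,
      (k ∈ s → ω ∈ A (φ k)) ∧ (k ∉ s → ω ∈ B (φ k)) := by
  -- A state consists of the finitely many atoms generated so far and the set of remaining indices.
  let St := {p : Set (Set Ω) × Set ℕ //
    p.1.Finite ∧ p.2.Infinite ∧ ∀ W ∈ p.1, Oscillates A B W p.2}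
  choose m hmM M' hM'sub hM'inf hM'osc using fun p : St =>
    Oscillates.exists_split p.2.1 p.2.2.1 p.2.2.2
  let next : St → St := fun p =>
    ⟨((fun W => W ∩ A (m p)) '' p.1.1 ∪ (fun W => W ∩ B (m p)) '' p.1.1, M' p),
      (p.2.1.image _).union (p.2.1.image _), hM'inf p, by
        rintro _ (⟨W, hW, rfl⟩ | ⟨W, hW, rfl⟩)
        · exact (hM'osc p W hW).1
        · exact (hM'osc p W hW).2⟩
  let st : ℕ → St := fun n => Nat.rec
    ⟨({Set.univ}, M), Set.finite_singleton _, hM, by rintro _ rfl; exact h⟩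
    (fun _ p => next p) n
  refine ⟨fun n => m (st n), strictMono_nat_of_lt_succ fun n => ?_, fun s n => ?_⟩
  · exact (hM'sub (st n) (hmM (st (n + 1)))).2
  · -- The atom that `s` selects at level `n`; it is nonempty because the pairs oscillate on it.
    have hW : ∃ W ∈ (st n).1.1, ∀ ω ∈ W, ∀ k < n,
        (k ∈ s → ω ∈ A (m (st k))) ∧ (k ∉ s → ω ∈ B (m (st k))) := by
      induction n with
      | zero => exact ⟨Set.univ, rfl, fun ω _ k hk => absurd hk (Nat.not_lt_zero k)⟩
      | succ n ih =>
        obtain ⟨W, hW, hWk⟩ := ih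
        by_cases hn : n ∈ s
        · refine ⟨W ∩ A (m (st n)), Or.inl ⟨W, hW, rfl⟩, fun ω hω k hk => ?_⟩
          obtain hlt | rfl := Nat.lt_succ_iff_lt_or_eq.1 hk
          · exact hWk ω hω.1 k hlt
          · exact ⟨fun _ => hω.2, fun h => absurd hn h⟩
        · refine ⟨W ∩ B (m (st n)), Or.inr ⟨W, hW, rfl⟩, fun ω hω k hk => ?_⟩
          obtain hlt | rfl := Nat.lt_succ_iff_lt_or_eq.1 hk
          · exact hWk ω hω.1 k hlt
          · exact ⟨fun h => absurd h hn, fun _ => hω.2⟩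
    obtain ⟨W, hW, hWk⟩ := hW
    by_contra hno
    refine (st n).2.2.2 W hW _ subset_rfl (st n).2.2.1 fun ω hω => ?_
    exact absurd ⟨ω, hWk ω hω⟩ hno

end Combinatorics

/-! ### Rosenthal's `ℓ₁` theorem -/

section Rosenthal

variable {𝕜 : Type*} [RCLike 𝕜] {X : Type*} [NormedAddCommGroup X] [NormedSpace 𝕜 X]

lemma norm_sum_smul_l1Basis (s : Finset ℕ) (a : ℕ → 𝕜) :
    ‖∑ n ∈ s, a n • l1Basis 𝕜 n‖ = ∑ n ∈ s, ‖a n‖ := by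
  have h := lp.norm_sum_single (E := fun _ : ℕ => 𝕜) (p := 1) (by simp) a s
  simp only [ENNReal.toReal_one, Real.rpow_one] at h
  rw [← h]
  congr 1
  refine Finset.sum_congr rfl fun n _ => ?_
  rw [l1Basis, ← lp.single_smul]
  simp

/-- The estimate behind the lower `ℓ₁`-bound, to be used with `g` the real and the imaginary part.
Evaluate `∑ a n • x n` at `f - f'`, where `f (x n)` is near `z₁` and `f' (x n)` near `z₂` if
`g (a n * (z₁ - z₂)) ≥ 0`, and the other way round if not: up to an error `2 * ρ * ‖a n‖`, every term
then contributes `|g (a n * (z₁ - z₂))|`. -/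
lemma sum_abs_le_of_independent {x : ℕ → X} {z₁ z₂ : 𝕜} {ρ : ℝ}
    (h : ∀ (s : Set ℕ) (n : ℕ), ∃ f : StrongDual 𝕜 X, ‖f‖ ≤ 1 ∧ ∀ k < n,
      (k ∈ s → ‖f (x k) - z₁‖ ≤ ρ) ∧ (k ∉ s → ‖f (x k) - z₂‖ ≤ ρ))
    (g : 𝕜 →+ ℝ) (hg : ∀ z, |g z| ≤ ‖z‖) (s : Finset ℕ) (a : ℕ → 𝕜) :
    ∑ n ∈ s, |g (a n * (z₁ - z₂))| ≤ 2 * ‖∑ n ∈ s, a n • x n‖ + 2 * ρ * ∑ n ∈ s, ‖a n‖ := by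
  set P : Set ℕ := {n | 0 ≤ g (a n * (z₁ - z₂))} with hP
  obtain ⟨f, hf, hfx⟩ := h P (s.sup id + 1)
  obtain ⟨f', hf', hfx'⟩ := h Pᶜ (s.sup id + 1)
  have hbound : ∀ c u v : 𝕜, ‖u - z₁‖ ≤ ρ → ‖v - z₂‖ ≤ ρ →
      g (c * (z₁ - z₂)) ≤ g (c * (u - v)) + 2 * ρ * ‖c‖ := by
    intro c u v hu hv
    have h1 : g (c * (z₁ - z₂)) = g (c * (u - v)) + g (c * ((v - z₂) - (u - z₁))) := by
      rw [← map_add]; congr 1; ring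
    have h2 : ‖c * ((v - z₂) - (u - z₁))‖ ≤ ‖c‖ * (ρ + ρ) := by
      rw [norm_mul]
      gcongr
      exact (norm_sub_le _ _).trans (add_le_add hv hu)
    have h3 := (le_abs_self _).trans ((hg _).trans h2)
    rw [h1]; linarith
  have hterm : ∀ n ∈ s, |g (a n * (z₁ - z₂))| ≤
      g (a n * (f (x n) - f' (x n))) + 2 * ρ * ‖a n‖ := by
    intro n hn
    have hlt : n < s.sup id + 1 := Nat.lt_succ_of_le (Finset.le_sup (f := id) hn)
    by_cases hnP : n ∈ P
    · rw [abs_of_nonneg hnP]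
      exact hbound _ _ _ ((hfx n hlt).1 hnP) ((hfx' n hlt).2 (by simpa using hnP))
    · rw [abs_of_neg (not_le.1 hnP), ← map_neg]
      have := hbound (-a n) _ _ ((hfx' n hlt).1 hnP) ((hfx n hlt).2 hnP)
      rw [norm_neg] at this
      convert this using 2
      · ring
      · congr 1; ring
  have hsum : ∑ n ∈ s, a n * (f (x n) - f' (x n)) =
      f (∑ n ∈ s, a n • x n) - f' (∑ n ∈ s, a n • x n) := by
    simp [map_sum, mul_sub, Finset.sum_sub_distrib]
  have hle : g (∑ n ∈ s, a n * (f (x n) - f' (x n))) ≤ 2 * ‖∑ n ∈ s, a n • x n‖ := by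
    rw [hsum]
    refine (le_abs_self _).trans ((hg _).trans ((norm_sub_le _ _).trans ?_))
    have h1 := f.le_of_opNorm_le hf (∑ n ∈ s, a n • x n)
    have h2 := f'.le_of_opNorm_le hf' (∑ n ∈ s, a n • x n)
    linarith
  calc _ ≤ ∑ n ∈ s, (g (a n * (f (x n) - f' (x n))) + 2 * ρ * ‖a n‖) := Finset.sum_le_sum hterm
    _ = g (∑ n ∈ s, a n * (f (x n) - f' (x n))) + 2 * ρ * ∑ n ∈ s, ‖a n‖ := by
      rw [Finset.sum_add_distrib, map_sum, Finset.mul_sum]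
    _ ≤ _ := by gcongr

/-- A bounded sequence on which the dual ball takes values near `z₁` and near `z₂` independently is
equivalent to the basis of `ℓ₁`. Summing the estimates for the real and the imaginary part bounds
`‖z₁ - z₂‖ * ∑ ‖a n‖` by `4 * ‖∑ a n • x n‖ + 4 * ρ * ∑ ‖a n‖`; with `ρ = ‖z₁ - z₂‖ / 10` the last
term can be absorbed. -/
lemma seqEquivalent_l1Basis_of_independent {x : ℕ → X} {K : ℝ} (hx : ∀ n, ‖x n‖ ≤ K) {z₁ z₂ : 𝕜}
    (hz : z₁ ≠ z₂)
    (h : ∀ (s : Set ℕ) (n : ℕ), ∃ f : StrongDual 𝕜 X, ‖f‖ ≤ 1 ∧ ∀ k < n,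
      (k ∈ s → ‖f (x k) - z₁‖ ≤ ‖z₁ - z₂‖ / 10) ∧
      (k ∉ s → ‖f (x k) - z₂‖ ≤ ‖z₁ - z₂‖ / 10)) :
    SeqEquivalent 𝕜 x (l1Basis 𝕜) := by
  have hd : 0 < ‖z₁ - z₂‖ := norm_pos_iff.2 (sub_ne_zero.2 hz)
  have hK : 0 ≤ K := (norm_nonneg _).trans (hx 0)
  refine ⟨‖z₁ - z₂‖ / 10, K + 1, by positivity, by positivity, fun s a => ?_⟩
  rw [norm_sum_smul_l1Basis]
  constructor
  · have hre := sum_abs_le_of_independent h (RCLike.re : 𝕜 →+ ℝ) RCLike.abs_re_le_norm s a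
    have him := sum_abs_le_of_independent h (RCLike.im : 𝕜 →+ ℝ) RCLike.abs_im_le_norm s a
    have htot : ‖z₁ - z₂‖ * ∑ n ∈ s, ‖a n‖ ≤
        ∑ n ∈ s, |RCLike.re (a n * (z₁ - z₂))| + ∑ n ∈ s, |RCLike.im (a n * (z₁ - z₂))| := by
      rw [Finset.mul_sum, ← Finset.sum_add_distrib]
      refine Finset.sum_le_sum fun n _ => ?_
      rw [mul_comm, ← norm_mul]
      refine (congrArg norm (RCLike.re_add_im (a n * (z₁ - z₂)))).symm.le.trans
        ((norm_add_le _ _).trans (add_le_add ?_ ?_))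
      · rw [RCLike.norm_ofReal]
      · rw [norm_mul, RCLike.norm_ofReal]
        refine mul_le_of_le_one_right (abs_nonneg _) ?_
        obtain hI | hI := eq_or_ne (RCLike.I : 𝕜) 0
        · simp [hI]
        · exact (RCLike.norm_I_of_ne_zero hI).le
    have hn := norm_nonneg (∑ n ∈ s, a n • x n)
    have hp : 0 ≤ ‖z₁ - z₂‖ * ∑ n ∈ s, ‖a n‖ :=
      mul_nonneg hd.le (Finset.sum_nonneg fun _ _ => norm_nonneg _)
    linarith
  · refine (norm_sum_le _ _).trans ?_
    rw [Finset.mul_sum]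
    refine Finset.sum_le_sum fun n _ => ?_
    rw [norm_smul, mul_comm]
    gcongr
    linarith [hx n]

/-- A bounded scalar sequence that does not visit two disjoint discs infinitely often, for countably
many pairs of discs with centres in a dense set, converges: two distinct cluster points would have
such a pair of discs around them. -/
lemma exists_tendsto_of_forall_disc_finite {u : ℕ → 𝕜} {K : ℝ} (hu : ∀ n, ‖u n‖ ≤ K)
    (h : ∀ i j, TopologicalSpace.denseSeq 𝕜 i ≠ TopologicalSpace.denseSeq 𝕜 j →
      {n | ‖u n - TopologicalSpace.denseSeq 𝕜 i‖ ≤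
        ‖TopologicalSpace.denseSeq 𝕜 i - TopologicalSpace.denseSeq 𝕜 j‖ / 10}.Finite ∨
      {n | ‖u n - TopologicalSpace.denseSeq 𝕜 j‖ ≤
        ‖TopologicalSpace.denseSeq 𝕜 i - TopologicalSpace.denseSeq 𝕜 j‖ / 10}.Finite) :
    ∃ z, Tendsto u atTop (𝓝 z) := by
  have hball : ∀ n, u n ∈ Metric.closedBall (0 : 𝕜) K := fun n => by simpa using hu n
  have hcpt : IsCompact (Metric.closedBall (0 : 𝕜) K) := isCompact_closedBall _ _
  obtain ⟨z, hz, hzc⟩ := hcpt.exists_mapClusterPt (f := atTop) (u := u)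
    (tendsto_principal.2 (Eventually.of_forall hball))
  refine ⟨z, hcpt.tendsto_nhds_of_unique_mapClusterPt (Eventually.of_forall hball) ?_⟩
  intro w hw hwc
  by_contra hne
  have hd : 0 < ‖w - z‖ := norm_pos_iff.2 (sub_ne_zero.2 hne)
  have happrox : ∀ v : 𝕜, ∃ i, ‖TopologicalSpace.denseSeq 𝕜 i - v‖ < ‖w - z‖ / 100 := by
    intro v
    obtain ⟨i, hi⟩ := (TopologicalSpace.denseRange_denseSeq 𝕜).exists_dist_lt v
      (show 0 < ‖w - z‖ / 100 by positivity)
    exact ⟨i, by rwa [dist_comm, dist_eq_norm] at hi⟩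
  obtain ⟨i, hi⟩ := happrox w
  obtain ⟨j, hj⟩ := happrox z
  set a := TopologicalSpace.denseSeq 𝕜 i
  set b := TopologicalSpace.denseSeq 𝕜 j
  have hab : ‖w - z‖ ≤ ‖a - b‖ + ‖w - z‖ / 50 := by
    have : w - z = (a - b) - (a - w) + (b - z) := by ring
    have h1 := norm_add_le ((a - b) - (a - w)) (b - z)
    have h2 := norm_sub_le (a - b) (a - w)
    rw [← this] at h1
    linarith
  have hinf : ∀ v c : 𝕜, MapClusterPt v atTop u → ‖c - v‖ < ‖w - z‖ / 100 →
      {n | ‖u n - c‖ ≤ ‖a - b‖ / 10}.Infinite := by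
    intro v c hv hc
    have hfr := hv.frequently (Metric.ball_mem_nhds v (show 0 < ‖w - z‖ / 100 by positivity))
    refine Nat.frequently_atTop_iff_infinite.1 (hfr.mono fun n hn => ?_)
    rw [dist_eq_norm] at hn
    have : u n - c = (u n - v) - (c - v) := by ring
    rw [this]
    have h1 := norm_sub_le (u n - v) (c - v)
    linarith
  have hane : a ≠ b := by
    intro hab'
    rw [hab', sub_self, norm_zero] at hab
    linarith
  exact (h i j hane).elim (hinf w a hwc hi) (hinf z b hzc hj)

/-- **Rosenthal's `ℓ₁` theorem**: a bounded sequence has a subsequence that is equivalent to the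
basis of `ℓ₁` or weakly Cauchy. Completeness of the scalars lets the latter be stated as
convergence of the values of each functional. -/
theorem exists_seqEquivalent_l1Basis_or_weakCauchy {x : ℕ → X} {K : ℝ} (hx : ∀ n, ‖x n‖ ≤ K) :
    (∃ φ : ℕ → ℕ, StrictMono φ ∧ SeqEquivalent 𝕜 (x ∘ φ) (l1Basis 𝕜)) ∨
    ∃ φ : ℕ → ℕ, StrictMono φ ∧ ∀ f : StrongDual 𝕜 X, ∃ z, Tendsto (fun n => f (x (φ n))) atTop
      (𝓝 z) := by
  let d : ℕ → 𝕜 := TopologicalSpace.denseSeq 𝕜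
  let A : ℕ → ℕ → 𝕜 → ℕ → Set (Metric.closedBall (0 : StrongDual 𝕜 X) 1) :=
    fun i j z n => {f | ‖f.1 (x n) - z‖ ≤ ‖d i - d j‖ / 10}
  by_cases hosc : ∃ i j, d i ≠ d j ∧ ∃ M : Set ℕ, M.Infinite ∧
      Oscillates (A i j (d i)) (A i j (d j)) Set.univ M
  · obtain ⟨i, j, hne, M, hM, hO⟩ := hosc
    obtain ⟨φ, hφ, hind⟩ := hO.exists_independent hM
    refine Or.inl ⟨φ, hφ, seqEquivalent_l1Basis_of_independent (fun n => hx (φ n)) hne ?_⟩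
    intro s n
    obtain ⟨f, hf⟩ := hind s n
    exact ⟨f.1, mem_closedBall_zero_iff.1 f.2, hf⟩
  · right
    push Not at hosc
    obtain ⟨L, -, hL, hQ⟩ := exists_infinite_subset_forall
      (Q := fun m L => d m.unpair.1 ≠ d m.unpair.2 →
        Settles (A m.unpair.1 m.unpair.2 (d m.unpair.1)) (A m.unpair.1 m.unpair.2 (d m.unpair.2))
          Set.univ L)
      (fun m L L' h hLL' hne => (h hne).mono hLL') Set.infinite_univ
      (fun m M' _ hM' => by
        by_cases hne : d m.unpair.1 = d m.unpair.2
        · exact ⟨M', subset_rfl, hM', fun h => absurd hne h⟩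
        · have := hosc _ _ hne M' hM'
          simp only [Oscillates, not_forall, not_not] at this
          obtain ⟨L, hL, hLinf, hS⟩ := this
          exact ⟨L, hL, hLinf, fun _ => hS⟩)
    have hφ := Nat.nth_strictMono (p := (· ∈ L)) hL
    have hmem : ∀ n, Nat.nth (· ∈ L) n ∈ L := fun n => Nat.nth_mem_of_infinite hL n
    refine ⟨Nat.nth (· ∈ L), hφ, ?_⟩
    have hball : ∀ f : StrongDual 𝕜 X, ‖f‖ ≤ 1 →
        ∃ z, Tendsto (fun n => f (x (Nat.nth (· ∈ L) n))) atTop (𝓝 z) := by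
      intro f hf
      refine exists_tendsto_of_forall_disc_finite (K := K) (fun n => ?_) fun i j hij => ?_
      · exact (f.le_of_opNorm_le hf _).trans (by simpa using hx _)
      · have hS := hQ (Nat.pair i j)
        simp only [Nat.unpair_pair] at hS
        refine (hS hij ⟨f, by simpa using hf⟩ trivial).imp (fun h => ?_) (fun h => ?_)
        · exact (h.preimage hφ.injective.injOn).subset fun n hn => ⟨hmem n, hn⟩
        · exact (h.preimage hφ.injective.injOn).subset fun n hn => ⟨hmem n, hn⟩
    -- Rescale an arbitrary functional into the unit ball.
    intro f
    have hpos : (0 : ℝ) < ‖f‖ + 1 := by positivity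
    have hne : ((‖f‖ + 1 : ℝ) : 𝕜) ≠ 0 := by exact_mod_cast hpos.ne'
    obtain ⟨z, hz⟩ := hball (((‖f‖ + 1 : ℝ) : 𝕜)⁻¹ • f) (by
      rw [norm_smul, norm_inv, RCLike.norm_ofReal, abs_of_pos hpos, inv_mul_le_iff₀ hpos]
      linarith)
    refine ⟨((‖f‖ + 1 : ℝ) : 𝕜) * z, ?_⟩
    have := hz.const_mul ((‖f‖ + 1 : ℝ) : 𝕜)
    simpa only [_root_.smul_apply, smul_eq_mul, mul_inv_cancel_left₀ hne] using this

end Rosenthal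

/-! ### The coarse `p`-DP* property and copies of `ℓ₁` -/

section CoarseLimited

variable {𝕜 : Type*} [RCLike 𝕜] {X Y : Type*} [NormedAddCommGroup X] [NormedSpace 𝕜 X]
  [NormedAddCommGroup Y] [NormedSpace 𝕜 Y] {p : ℝ≥0∞} [Fact (1 ≤ p)]

lemma exists_separated_seq {E : Type*} [PseudoMetricSpace E] {s : Set E}
    (hs : ¬ TotallyBounded s) :
    ∃ ε > 0, ∃ y : ℕ → E, (∀ n, y n ∈ s) ∧ ∀ m n, m < n → ε ≤ dist (y m) (y n) := by
  rw [Metric.totallyBounded_iff] at hs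
  push Not at hs
  obtain ⟨ε, hε, hs⟩ := hs
  obtain ⟨y, hy, hsep⟩ := exists_seq_of_forall_finset_exists (· ∈ s) (fun a b => ε ≤ dist a b)
    (fun t _ => by
      obtain ⟨b, hb, hbt⟩ := Set.not_subset.1 (hs t t.finite_toSet)
      refine ⟨b, hb, fun a ha => ?_⟩
      by_contra hlt
      refine hbt (Set.mem_iUnion₂.2 ⟨a, ha, ?_⟩)
      rw [Metric.mem_ball, dist_comm]
      exact not_le.1 hlt)
  exact ⟨ε, hε, y, hy, hsep⟩

lemma isRelWeaklyCompact_range {y : ℕ → X}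
    (hy : ∀ f : StrongDual 𝕜 X, Tendsto (fun n => f (y n)) atTop (𝓝 0)) :
    IsRelWeaklyCompact 𝕜 (Set.range y) := by
  have ht : Tendsto (fun n => toWeakSpace 𝕜 X (y n)) atTop (𝓝 (0 : WeakSpace 𝕜 X)) := by
    refine (WeakBilin.tendsto_iff_forall_eval_tendsto (B := (topDualPairing 𝕜 X).flip) ?_).2 ?_
    · intro a b hab
      refine sub_eq_zero.1 (SeparatingDual.eq_zero_of_forall_dual_eq_zero (R := 𝕜)
        (V := X) fun f => ?_)
      have := DFunLike.congr_fun hab f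
      rw [map_sub, sub_eq_zero]
      exact this
    · intro f
      have := hy f
      rw [← map_zero f] at this
      exact this
  refine ht.isCompact_insert_range.closure_of_subset ?_
  rintro _ ⟨_, ⟨n, rfl⟩, rfl⟩
  exact Or.inr ⟨n, rfl⟩

/-- An operator into `ℓ_p` on a space with the coarse `p`-DP* property does not keep a weakly null
sequence away from `0`: a norm limit of a subsequence of the images is their weak limit `0`. -/
lemma HasCoarseDPStar.exists_norm_lt (hX : HasCoarseDPStar 𝕜 X p) (R : X →L[𝕜] SeqSpace 𝕜 p)
    {y : ℕ → X} (hy : ∀ f : StrongDual 𝕜 X, Tendsto (fun n => f (y n)) atTop (𝓝 0))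
    {ε : ℝ} (hε : 0 < ε) : ∃ n, ‖R (y n)‖ < ε := by
  have hK := hX _ (isRelWeaklyCompact_range hy) R
  obtain ⟨z, -, φ, hφ, hz⟩ := hK.tendsto_subseq (x := fun n => R (y n))
    fun n => subset_closure ⟨_, ⟨n, rfl⟩, rfl⟩
  have hz0 : z = 0 := by
    refine SeparatingDual.eq_zero_of_forall_dual_eq_zero (R := 𝕜) fun f => ?_
    exact tendsto_nhds_unique ((f.continuous.tendsto z).comp hz)
      ((hy (f.comp R)).comp hφ.tendsto_atTop)
  rw [hz0] at hz
  obtain ⟨n, hn⟩ := (hz.norm.eventually_lt_const (u := ε) (by simpa using hε)).exists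
  exact ⟨φ n, hn⟩

lemma HasCoarseDPStar.exists_seqEquivalent_l1Basis (hX : HasCoarseDPStar 𝕜 X p)
    (R : X →L[𝕜] SeqSpace 𝕜 p) {x : ℕ → X} {K : ℝ} (hx : ∀ n, ‖x n‖ ≤ K) {ε : ℝ} (hε : 0 < ε)
    (hsep : ∀ m n, m < n → ε ≤ ‖R (x m) - R (x n)‖) :
    ∃ φ : ℕ → ℕ, StrictMono φ ∧ SeqEquivalent 𝕜 (x ∘ φ) (l1Basis 𝕜) := by
  refine (exists_seqEquivalent_l1Basis_or_weakCauchy hx).resolve_right ?_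
  rintro ⟨φ, hφ, hconv⟩
  obtain ⟨n, hn⟩ := hX.exists_norm_lt R (y := fun n => x (φ n) - x (φ (n + 1))) (fun f => by
    obtain ⟨z, hz⟩ := hconv f
    simpa using hz.sub (hz.comp (tendsto_add_atTop_nat 1))) hε
  rw [map_sub] at hn
  exact (hsep _ _ (hφ n.lt_succ_self)).not_gt hn

/-- The map `a ↦ ∑' n, a n • x n` embeds `ℓ₁` onto a subspace of `X`. -/
lemma SeqEquivalent.containsCopyOfL1 [CompleteSpace X] {x : ℕ → X}
    (h : SeqEquivalent 𝕜 x (l1Basis 𝕜)) : ContainsCopyOfL1 𝕜 X := by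
  obtain ⟨c, C, hc, hC, h⟩ := h
  simp only [norm_sum_smul_l1Basis] at h
  have hx : ∀ n, ‖x n‖ ≤ C := fun n => by simpa using (h {n} fun _ => 1).2
  have hnorm : ∀ a : SeqSpace 𝕜 1, HasSum (fun n => ‖a n‖) ‖a‖ := fun a => by
    simpa using lp.hasSum_norm (p := 1) (by simp) a
  have hsum : ∀ a : SeqSpace 𝕜 1, Summable fun n => a n • x n := fun a => by
    refine Summable.of_norm_bounded ((hnorm a).summable.mul_left C) fun n => ?_
    rw [norm_smul, mul_comm]
    gcongr
    exact hx n
  let U₀ : SeqSpace 𝕜 1 →ₗ[𝕜] X :=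
    { toFun := fun a => ∑' n, a n • x n
      map_add' := fun a b => by
        rw [← (hsum a).tsum_add (hsum b)]
        simp [add_smul]
      map_smul' := fun k a => by
        rw [RingHom.id_apply, ← (hsum a).tsum_const_smul]
        simp [mul_smul] }
  have hlim : ∀ a : SeqSpace 𝕜 1, Tendsto (fun s : Finset ℕ => ‖∑ n ∈ s, a n • x n‖) atTop
      (𝓝 ‖U₀ a‖) := fun a => (hsum a).hasSum.norm
  have hU : ∀ a, ‖U₀ a‖ ≤ C * ‖a‖ := fun a =>
    le_of_tendsto_of_tendsto' (hlim a) ((hnorm a).const_mul C) fun s => by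
      simpa [Finset.mul_sum] using (h s a).2
  have hL : ∀ a, c * ‖a‖ ≤ ‖U₀ a‖ := fun a =>
    le_of_tendsto_of_tendsto' ((hnorm a).const_mul c) (hlim a) fun s => by
      simpa [Finset.mul_sum] using (h s a).1
  let U : SeqSpace 𝕜 1 →L[𝕜] X := U₀.mkContinuous C hU
  have hanti : AntilipschitzWith (Real.toNNReal c⁻¹) U :=
    U.antilipschitz_of_bound fun a => by
      rw [Real.coe_toNNReal _ (inv_nonneg.2 hc.le), inv_mul_eq_div, le_div_iff₀ hc, mul_comm]
      exact hL a
  exact ⟨_, ⟨U.equivRange hanti.injective (hanti.isClosed_range U.uniformContinuous)⟩⟩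

lemma exists_separated_image_of_not_isCoarseLimitedOp {T : X →L[𝕜] Y}
    (hT : ¬ IsCoarseLimitedOp p T) :
    ∃ (S : Y →L[𝕜] SeqSpace 𝕜 p) (x : ℕ → X) (ε : ℝ), (∀ n, ‖x n‖ ≤ 1) ∧ 0 < ε ∧
      ∀ m n, m < n → ε ≤ ‖S (T (x m)) - S (T (x n))‖ := by
  simp only [IsCoarseLimitedOp, IsCoarseLimitedSet, not_forall] at hT
  obtain ⟨S, hS⟩ := hT
  obtain ⟨ε, hε, y, hy, hsep⟩ := exists_separated_seq fun hTB =>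
    hS (hTB.closure.isCompact_of_isClosed isClosed_closure)
  choose w hw hwy using hy
  choose x hx hxw using hw
  refine ⟨S, x, ε, fun n => by simpa using hx n, hε, fun m n hmn => ?_⟩
  rw [hxw, hxw, hwy, hwy, ← dist_eq_norm]
  exact hsep m n hmn

end CoarseLimited

end CoarseLimited

theorem theorem4p4 {𝕜 : Type*} [RCLike 𝕜]
    {X : Type*} [NormedAddCommGroup X] [NormedSpace 𝕜 X] [CompleteSpace X]
    {Y : Type*} [NormedAddCommGroup Y] [NormedSpace 𝕜 Y] [CompleteSpace Y]
    (p : ℝ≥0∞) [Fact (1 ≤ p)] (hp : p ≠ ∞)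
    (hX : CoarseLimited.HasCoarseDPStar 𝕜 X p) :
    (∀ T : X →L[𝕜] Y, ¬ CoarseLimited.IsCoarseLimitedOp p T →
      ∃ x : ℕ → X, CoarseLimited.SeqEquivalent 𝕜 x (CoarseLimited.l1Basis 𝕜) ∧
        (CoarseLimited.HasCoarseDPStar 𝕜 Y p →
          ∃ φ : ℕ → ℕ, StrictMono φ ∧
            CoarseLimited.SeqEquivalent 𝕜 (fun k => T (x (φ k))) (CoarseLimited.l1Basis 𝕜))) ∧
    (¬ CoarseLimited.ContainsCopyOfL1 𝕜 X →
      ∀ T : X →L[𝕜] Y, CoarseLimited.IsCoarseLimitedOp p T) := by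
  have key : ∀ T : X →L[𝕜] Y, ¬ CoarseLimited.IsCoarseLimitedOp p T →
      ∃ x : ℕ → X, CoarseLimited.SeqEquivalent 𝕜 x (CoarseLimited.l1Basis 𝕜) ∧
        (CoarseLimited.HasCoarseDPStar 𝕜 Y p →
          ∃ φ : ℕ → ℕ, StrictMono φ ∧
            CoarseLimited.SeqEquivalent 𝕜 (fun k => T (x (φ k))) (CoarseLimited.l1Basis 𝕜)) := by
    intro T hT
    obtain ⟨S, x, ε, hx, hε, hsep⟩ :=
      CoarseLimited.exists_separated_image_of_not_isCoarseLimitedOp hT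
    obtain ⟨φ, hφ, hequiv⟩ := hX.exists_seqEquivalent_l1Basis (S.comp T) hx hε hsep
    refine ⟨x ∘ φ, hequiv, fun hY => ?_⟩
    exact hY.exists_seqEquivalent_l1Basis S (x := fun k => T (x (φ k)))
      (fun k => T.le_opNorm_of_le (hx (φ k))) hε fun m n hmn => hsep _ _ (hφ hmn)
  refine ⟨key, fun hcopy T => ?_⟩
  by_contra hT
  obtain ⟨x, hx, -⟩ := key T hT
  exact hcopy hx.containsCopyOfL1
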